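/- Let $d\ge 1$ and let $\mathsf M$ be a weakly stationary random measure on $\mathbb R^d$, i.e. a family of complex square-integrable random variables $\mathsf M(f)$ on a probability space $(\Omega,\mathbf P)$, indexed by the measurable, bounded, compactly supported functions $f:\mathbb R^d\to\mathbb C$ (test functions), such that almost surely, on each compact set, $f\mapsto\mathsf M(f)$ is integration against a complex measure, and such that $\operatorname{Var}\mathsf M(f)=\mathbf E|\mathsf M(f)-\mathbf E\mathsf M(f)|^2$ is unchanged when $f$ is translated. Let $\mathsf S$ be its spectral measure, i.e. the nonnegative measure with $$\operatorname{Var}\mathsf M(f)=(2\pi)^{-d}\int_{\mathbb R^d}|\hat f|^2\,d\mathsf S,\qquad \hat f(u)=\int_{\mathbb R^d} e^{-iu\cdot x}f(x)\,dx,$$ for all test functions $f$, and let the spectral density $\mathsf s$ be the density of the absolutely continuous part of $\mathsf S$ with respect to Lebesgue measure (the singular part is arbitrary). Call $\mathsf s$ *determining* if the only entire function $\psi:\mathbb C^d\to\mathbb C$ with $\int_{\mathbb R^d}|\psi|^2\mathsf s^{-1}\,du<\infty$ is $\psi=0$ (with $a/0=\infty$ for $a>0$ and $0/0=0$). (1)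 Suppose that $\mathsf s$ is determining. Then for every bounded set $A\subset\mathbb R^d$: (a) $\mathsf M$ is maximally rigid on $A$: up to $\mathbf P$-null sets, $\sigma(\mathsf M 1_A)\subset\sigma(\mathsf M 1_{A^c})$, where $\sigma(\mathsf M1_B)$ is generated by the $\mathsf M(f)$ for test functions $f$ vanishing off $B$; (b) $\mathsf M-\mathbf E\mathsf M$ is linearly maximally rigid on $A$: for every test function $f$ vanishing off $A$ there are test functions $h_n$ vanishing on $A$ with $\mathsf M(h_n)-\mathbf E\mathsf M(h_n)\to\mathsf M(f)-\mathbf E\mathsf M(f)$ in $L^2(\mathbf P)$; (c) if the mean $f\mapsto\mathbf E\mathsf M(f)$ is also translation invariant, then $\mathsf M$ itself is linearly maximally rigid on $A$: the $h_n$ can be chosen such that $\mathsf M(h_n)\to\mathsf M(f)$ in $L^2(\mathbf P)$. (2) If $\mathsf s$ has a deep zero, i.e. there is $u_0\in\mathbb R^d$ such that for every $k\in\mathbb N$ there are $C$ and $\varepsilon>0$ with $\mathsf s(u)\le C\|u-u_0\|^k$ for almost every $u\in B(u_0,\varepsilon)$ (for instance if $\mathsf s$ vanishes almost everywhere on a nonempty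 open set), then $\mathsf s$ is determining. (3) If $d=1$ and there is $u_0\in\mathbb R$ such that $\int_{B(u_0,\varepsilon)}|u-u_0|^k\,\mathsf s(u)^{-1}du=\infty$ for all $k\in\mathbb N$ and all $\varepsilon>0$, then $\mathsf s$ is determining. -/

import Mathlib

open MeasureTheory Filter Topology
open scoped ENNReal

noncomputable section

/-- `ℝ^d` with its Euclidean norm. -/
abbrev RSpace (d : ℕ) : Type := EuclideanSpace ℝ (Fin d)

/-- The test functions on which a random measure acts: measurable, bounded and compactly supported
functions `ℝ^d → ℂ`. -/
structure IsTestFn {d : ℕ} (f : RSpace d → ℂ) : Prop where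
  measurable : Measurable f
  bounded : ∃ C : ℝ, ∀ x, ‖f x‖ ≤ C
  compactSupport : HasCompactSupport f

/-- Test functions that live on `B`: they vanish off `B`. -/
structure IsTestFnOn {d : ℕ} (B : Set (RSpace d)) (f : RSpace d → ℂ) : Prop extends IsTestFn f where
  zero_off : ∀ x, x ∉ B → f x = 0

/-- Translation of a function by `x`. -/
def translateFn {d : ℕ} (x : RSpace d) (f : RSpace d → ℂ) : RSpace d → ℂ := fun y => f (y - x)

/-- The variance `E |X - E X|²` of a complex random variable. -/
def complexVar {Ω : Type*} [MeasurableSpace Ω] (P : Measure Ω) (X : Ω → ℂ) : ℝ≥0∞ :=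
  ∫⁻ ω, ‖X ω - ∫ ω', X ω' ∂P‖ₑ ^ 2 ∂P

/-- A weakly stationary (complex-valued) random measure on `ℝ^d`, given by its linear statistics
`M f`, which are square integrable random variables; only the values on test functions matter.
Almost surely `M` is given on each compact set by a complex measure, and the variances of the linear
statistics are translation invariant. -/
structure IsWeaklyStationaryRandomMeasure {d : ℕ} {Ω : Type*} [MeasurableSpace Ω] (P : Measure Ω)
    (M : (RSpace d → ℂ) → Ω → ℂ) : Prop where
  measurable : ∀ f, IsTestFn f → Measurable (M f)
  memLp : ∀ f, IsTestFn f → MemLp (M f) 2 P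
  ae_measure : ∀ᵐ ω ∂P, ∀ K : Set (RSpace d), IsCompact K →
    ∃ ν : ComplexMeasure (RSpace d), ∀ f, IsTestFnOn K f →
      M f ω = VectorMeasure.integral ν f (ContinuousLinearMap.mul ℝ ℂ)
  stationary : ∀ (x : RSpace d) f, IsTestFn f →
    complexVar P (M (translateFn x f)) = complexVar P (M f)

/-- The mean of the random measure is translation invariant. -/
def HasStationaryMean {d : ℕ} {Ω : Type*} [MeasurableSpace Ω] (P : Measure Ω)
    (M : (RSpace d → ℂ) → Ω → ℂ) : Prop :=
  ∀ (x : RSpace d) f, IsTestFn f → ∫ ω, M (translateFn x f) ω ∂P = ∫ ω, M f ω ∂P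

/-- The centred random measure `M - E M`. -/
def centred {d : ℕ} {Ω : Type*} [MeasurableSpace Ω] (P : Measure Ω)
    (M : (RSpace d → ℂ) → Ω → ℂ) : (RSpace d → ℂ) → Ω → ℂ :=
  fun f ω => M f ω - ∫ ω', M f ω' ∂P

/-- The Fourier transform `u ↦ ∫ exp (-i u·x) f x dx`. -/
def fourierHat {d : ℕ} (f : RSpace d → ℂ) (u : RSpace d) : ℂ :=
  ∫ x : RSpace d, Complex.exp (-(Complex.I * ((inner ℝ u x : ℝ) : ℂ))) * f x

/-- `S` is the spectral measure of `M`: the nonnegative measure for which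
`Var (M f) = (2π)^{-d} ∫ |f̂|² dS` for all test functions `f`. -/
def IsSpectralMeasure {d : ℕ} {Ω : Type*} [MeasurableSpace Ω] (P : Measure Ω)
    (M : (RSpace d → ℂ) → Ω → ℂ) (S : Measure (RSpace d)) : Prop :=
  ∀ f, IsTestFn f → complexVar P (M f) =
    ENNReal.ofReal (((2 * Real.pi) ^ d)⁻¹) * ∫⁻ u, ‖fourierHat f u‖ₑ ^ 2 ∂S

/-- `s` is the spectral density of `M`: the density of the absolutely continuous part in the
Lebesgue decomposition of the spectral measure. The singular part is arbitrary. -/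
def HasSpectralDensity {d : ℕ} {Ω : Type*} [MeasurableSpace Ω] (P : Measure Ω)
    (M : (RSpace d → ℂ) → Ω → ℂ) (s : RSpace d → ℝ≥0∞) : Prop :=
  ∃ S σ : Measure (RSpace d), IsSpectralMeasure P M S ∧ Measurable s ∧
    σ ⟂ₘ (volume : Measure (RSpace d)) ∧ S = σ + volume.withDensity s

/-- `s` is determining: the only entire function `ψ` on `ℂ^d` with `∫_{ℝ^d} |ψ|² / s < ∞` is `0`.
In `ℝ≥0∞` one has `a / 0 = ∞` for `a ≠ 0` and `0 / 0 = 0`, so `ψ` has to vanish almost everywhere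
on `{s = 0}`. -/
def IsDetermining {d : ℕ} (s : RSpace d → ℝ≥0∞) : Prop :=
  ∀ ψ : (Fin d → ℂ) → ℂ, Differentiable ℂ ψ →
    ∫⁻ u : RSpace d, ‖ψ (fun i => (u i : ℂ))‖ₑ ^ 2 / s u < ∞ → ψ = 0

/-- `s` has a deep zero: at some point it vanishes to infinite order
(up to Lebesgue-null sets, since `s` is a density). -/
def HasDeepZero {d : ℕ} (s : RSpace d → ℝ≥0∞) : Prop :=
  ∃ u₀ : RSpace d, ∀ k : ℕ, ∃ C ε : ℝ, 0 < ε ∧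
    ∀ᵐ u ∂(volume : Measure (RSpace d)), ‖u - u₀‖ < ε → s u ≤ ENNReal.ofReal (C * ‖u - u₀‖ ^ k)

/-- The integral form of a deep zero: at some point `u₀`, all the integrals
`∫_{B(u₀, ε)} ‖u - u₀‖^k / s u du` are infinite. -/
def HasIntegralDeepZero {d : ℕ} (s : RSpace d → ℝ≥0∞) : Prop :=
  ∃ u₀ : RSpace d, ∀ k : ℕ, ∀ ε : ℝ, 0 < ε →
    ∫⁻ u in Metric.ball u₀ ε, ‖u - u₀‖ₑ ^ k / s u = ∞

/-- The σ-algebra generated by the restriction of `M` to `B`. -/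
def sigmaOn {d : ℕ} {Ω : Type*} (M : (RSpace d → ℂ) → Ω → ℂ) (B : Set (RSpace d)) :
    MeasurableSpace Ω :=
  ⨆ f : {f : RSpace d → ℂ // IsTestFnOn B f}, MeasurableSpace.comap (M f.1) (borel ℂ)

/-- Maximal rigidity on `B`: `σ(M 1_B) ⊆ σ(M 1_{Bᶜ})`, up to `P`-null sets. -/
def IsMaximallyRigidOn {d : ℕ} {Ω : Type*} [MeasurableSpace Ω] (P : Measure Ω)
    (M : (RSpace d → ℂ) → Ω → ℂ) (B : Set (RSpace d)) : Prop :=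
  ∀ E : Set Ω, MeasurableSet[sigmaOn M B] E →
    ∃ F : Set Ω, MeasurableSet[sigmaOn M Bᶜ] F ∧ E =ᵐ[P] F

/-- Linear maximal rigidity on `B`: each `M f` with `f` living on `B` is an `L²(P)` limit of
linear statistics `M (h n)` with `h n` living on `Bᶜ`. -/
def IsLinearlyMaximallyRigidOn {d : ℕ} {Ω : Type*} [MeasurableSpace Ω] (P : Measure Ω)
    (M : (RSpace d → ℂ) → Ω → ℂ) (B : Set (RSpace d)) : Prop :=
  ∀ f, IsTestFnOn B f → ∃ h : ℕ → RSpace d → ℂ, (∀ n, IsTestFnOn Bᶜ (h n)) ∧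
    Tendsto (fun n => eLpNorm (M (h n) - M f) 2 P) atTop (𝓝 0)

end

/-! Up to a constant, `f ↦ f̂` carries the centred statistics isometrically into L²(S). Linear
rigidity on A therefore says that `f̂`, for f living on A, lies in the closure of the transforms of
test functions living off A.

By duality, let y in L²(S) be orthogonal to all of those. Translating f by x multiplies `f̂` by
exp(-i u·x), so F(x) = ⟨y, exp(-i u·x) f̂⟩ is the Fourier transform of the finite complex measure ȳ
f̂ dS. It vanishes once x moves A off itself, so F has compact support. Then ȳ f̂ dS has a density G
that extends to an entire function (the easy half of Paley–Wiener), and G = s ȳ f̂ almost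
everywhere. As `f̂` is bounded, ∫ |G|²/s ≤ ∫ |y f̂|² dS < ∞. A determining s forces G = 0, so F = 0,
and F(0) = 0 says that y is orthogonal to `f̂`. This is `eq_zero_of_hasCompactSupport_fourier` and
`exists_testFn_approx`.

To control means as well, the argument runs in L²(S) × ℂ, with the mean as second coordinate. An
invariant mean only adds a constant to F, that is, a point mass at frequency 0, which is
Lebesgue-null. Maximal rigidity follows from the linear kind by passing to almost surely convergent
subsequences.

The criteria for determining densities compare the decay of s at u₀ with the finite vanishing order
of a nonzero entire function on a line. -/

/-! ### Entire functions and the two deep zero criteria -/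

/-- The embedding `ℝ^d → ℂ^d`. -/
def complexify {d : ℕ} (u : RSpace d) : Fin d → ℂ := fun i => (u i : ℂ)

lemma continuous_complexify {d : ℕ} : Continuous (complexify (d := d)) := by
  unfold complexify; fun_prop

lemma complexify_add_smul {d : ℕ} (u v : RSpace d) (t : ℝ) :
    complexify (u + t • v) = complexify u + (t : ℂ) • complexify v := by
  ext i; simp [complexify]

lemma differentiable_along_line {d : ℕ} {ψ : (Fin d → ℂ) → ℂ} (hψ : Differentiable ℂ ψ)
    (a b : Fin d → ℂ) : Differentiable ℂ fun t : ℂ => ψ (a + t • b) := by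
  fun_prop

/-- An entire function of one variable that is not zero is of exact finite order at the origin. -/
lemma exists_order_of_entire {g : ℂ → ℂ} (hg : Differentiable ℂ g) (h0 : g ≠ 0) :
    ∃ (m : ℕ) (h : ℂ → ℂ), ContinuousAt h 0 ∧ h 0 ≠ 0 ∧ ∀ᶠ z in 𝓝 0, g z = z ^ m * h z := by
  have ha : AnalyticOnNhd ℂ g Set.univ := fun z _ => hg.analyticAt z
  by_cases hz : ∀ᶠ z in 𝓝 (0 : ℂ), g z = 0
  · exact absurd (funext fun z =>
      ha.eqOn_zero_of_preconnected_of_eventuallyEq_zero isPreconnected_univ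
        (Set.mem_univ 0) hz (Set.mem_univ z)) h0
  · obtain ⟨m, h, hh, hne, heq⟩ :=
      (ha 0 (Set.mem_univ _)).exists_eventuallyEq_pow_smul_nonzero_iff.mpr hz
    exact ⟨m, h, hh.continuousAt, hne, by simpa using heq⟩

/-- If g(z) = z^m k(z) near 0 with k(0) ≠ 0, the sequence with N = 2m tends to |k(0)|² ≠ 0. The
hypothesis is on lower limits because that is what Fatou's lemma delivers. -/
lemma entire_eq_zero_of_liminf {g : ℂ → ℂ} (hg : Differentiable ℂ g)
    (h : ∀ N : ℕ, liminf (fun n : ℕ => ((n + 1 : ℕ) : ℝ≥0∞) ^ N *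
      ‖g (((n + 1 : ℕ) : ℝ)⁻¹ : ℝ)‖ₑ ^ 2) atTop = 0) : g = 0 := by
  by_contra h0
  obtain ⟨m, k, hk, hk0, heq⟩ := exists_order_of_entire hg h0
  have hlim : Tendsto (fun n : ℕ => ((((n + 1 : ℕ) : ℝ)⁻¹ : ℝ) : ℂ)) atTop (𝓝 0) := by
    have h1 : Tendsto (fun n : ℕ => (((n + 1 : ℕ) : ℝ)⁻¹ : ℝ)) atTop (𝓝 0) := by
      have := tendsto_one_div_add_atTop_nhds_zero_nat (𝕜 := ℝ)
      simpa using this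
    exact (Complex.continuous_ofReal.tendsto' 0 0 (by simp)).comp h1
  have h2 : Tendsto (fun n : ℕ => ‖k (((n + 1 : ℕ) : ℝ)⁻¹ : ℝ)‖ₑ ^ 2) atTop (𝓝 (‖k 0‖ₑ ^ 2)) :=
    ((ENNReal.continuous_pow 2).tendsto _).comp
      ((continuous_enorm.tendsto _).comp (hk.tendsto.comp hlim))
  have h3 : Tendsto (fun n : ℕ => ((n + 1 : ℕ) : ℝ≥0∞) ^ (2 * m) *
      ‖g (((n + 1 : ℕ) : ℝ)⁻¹ : ℝ)‖ₑ ^ 2) atTop (𝓝 (‖k 0‖ₑ ^ 2)) := by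
    refine h2.congr' ?_
    filter_upwards [hlim.eventually heq] with n hn
    have e1 : ‖(((((n + 1 : ℕ) : ℝ)⁻¹ : ℝ) : ℂ))‖ₑ = ((n + 1 : ℕ) : ℝ≥0∞)⁻¹ := by
      rw [← ofReal_norm, Complex.norm_real, Real.norm_of_nonneg (by positivity),
        ENNReal.ofReal_inv_of_pos (by positivity), ENNReal.ofReal_natCast]
    rw [hn, enorm_mul, mul_pow, enorm_pow, e1, ← pow_mul, mul_comm m 2, ← mul_assoc, ← mul_pow,
      ENNReal.mul_inv_cancel (by positivity) (by finiteness), one_pow, one_mul]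
  have h4 := h3.liminf_eq
  rw [h] at h4
  exact hk0 (by simpa using h4.symm)

lemma entire_eq_zero_of_real {g : ℂ → ℂ} (hg : Differentiable ℂ g) {r : ℝ} (hr : 0 < r)
    (h : ∀ t : ℝ, |t| < r → g t = 0) : g = 0 := by
  refine entire_eq_zero_of_liminf hg fun N => ?_
  have h1 : Tendsto (fun n : ℕ => (((n + 1 : ℕ) : ℝ)⁻¹ : ℝ)) atTop (𝓝 0) := by
    have := tendsto_one_div_add_atTop_nhds_zero_nat (𝕜 := ℝ)
    simpa using this
  refine Tendsto.liminf_eq (tendsto_const_nhds.congr' ?_)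
  filter_upwards [h1.eventually (gt_mem_nhds hr)] with n hn
  rw [h _ (by rwa [abs_of_nonneg (by positivity)])]
  simp

/-- An entire function on `ℂ^d` vanishing on a real ball is zero. -/
lemma entire_eq_zero_of_real_ball {d : ℕ} {ψ : (Fin d → ℂ) → ℂ} (hψ : Differentiable ℂ ψ)
    (u₀ : RSpace d) {r : ℝ} (hr : 0 < r) (h : ∀ v, ‖v‖ < r → ψ (complexify (u₀ + v)) = 0) :
    ψ = 0 := by
  have hreal : ∀ w : RSpace d, ψ (complexify w) = 0 := by
    intro w
    have := entire_eq_zero_of_real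
      (differentiable_along_line hψ (complexify u₀) (complexify (w - u₀)))
      (r := r / (‖w - u₀‖ + 1)) (by positivity) fun t ht => by
        rw [← complexify_add_smul]
        refine h _ ?_
        rw [norm_smul, Real.norm_eq_abs]
        rw [lt_div_iff₀ (by positivity)] at ht
        nlinarith [abs_nonneg t]
    have := congrFun this ((1 : ℝ) : ℂ)
    simpa only [← complexify_add_smul, one_smul, add_sub_cancel, Pi.zero_apply] using this
  ext z
  -- The complex line t ↦ Re z + t Im z stays in ℝ^d for real t and reaches z at t = i.
  have := entire_eq_zero_of_real
    (differentiable_along_line hψ (complexify (WithLp.toLp 2 fun i => (z i).re))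
      (complexify (WithLp.toLp 2 fun i => (z i).im)))
    one_pos fun t _ => by
      rw [← complexify_add_smul]
      exact hreal _
  have := congrFun this Complex.I
  refine Eq.trans (congrArg ψ ?_) this
  ext i
  simp [complexify, mul_comm Complex.I]

lemma lintegral_ball_comp_scale {d : ℕ} {f : RSpace d → ℝ≥0∞} (hf : Measurable f)
    (u₀ : RSpace d) (n : ℕ) :
    ∫⁻ v in Metric.ball (0 : RSpace d) 1, f (u₀ + ((n + 1 : ℕ) : ℝ)⁻¹ • v) =
      ((n + 1 : ℕ) : ℝ≥0∞) ^ d * ∫⁻ u in Metric.ball u₀ ((n + 1 : ℕ) : ℝ)⁻¹, f u := by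
  set r : ℝ := ((n + 1 : ℕ) : ℝ)⁻¹ with hr
  have hr0 : 0 < r := by positivity
  set F : RSpace d → ℝ≥0∞ := fun w => (Metric.ball u₀ r).indicator f (u₀ + w) with hF
  have hFm : Measurable F := (hf.indicator Metric.isOpen_ball.measurableSet).comp (by fun_prop)
  have h1 : ∫⁻ v in Metric.ball (0 : RSpace d) 1, f (u₀ + r • v) = ∫⁻ v, F (r • v) := by
    rw [← lintegral_indicator Metric.isOpen_ball.measurableSet]
    refine lintegral_congr fun v => ?_
    have hiff : u₀ + r • v ∈ Metric.ball u₀ r ↔ v ∈ Metric.ball (0 : RSpace d) 1 := by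
      simp only [Metric.mem_ball, dist_zero_right, dist_self_add_left, norm_smul,
        Real.norm_of_nonneg hr0.le]
      constructor
      · intro h; by_contra h'; nlinarith
      · intro h; nlinarith
    change _ = (Metric.ball u₀ r).indicator f (u₀ + r • v)
    by_cases hv : v ∈ Metric.ball (0 : RSpace d) 1
    · rw [Set.indicator_of_mem hv, Set.indicator_of_mem (hiff.2 hv)]
    · rw [Set.indicator_of_notMem hv, Set.indicator_of_notMem (mt hiff.1 hv)]
  rw [h1, ← lintegral_map hFm (measurable_const_smul r),
    Measure.map_addHaar_smul volume hr0.ne', lintegral_smul_measure]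
  have h2 : ENNReal.ofReal |(r ^ Module.finrank ℝ (RSpace d))⁻¹| = ((n + 1 : ℕ) : ℝ≥0∞) ^ d := by
    rw [abs_of_nonneg (by positivity), hr, inv_pow, inv_inv, finrank_euclideanSpace_fin,
      ENNReal.ofReal_pow (by positivity), ENNReal.ofReal_natCast]
  rw [h2, smul_eq_mul, hF,
    lintegral_add_left_eq_self (fun w => (Metric.ball u₀ r).indicator f w) u₀,
    lintegral_indicator Metric.isOpen_ball.measurableSet]

/-- Writing |ψ|² = s · (|ψ|²/s), the mass of |ψ|² on B(u₀, r) is O(r^k) for every k. Rescaling to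
the unit ball and applying Fatou, ψ vanishes to infinite order at u₀ along the line in almost every
direction v, hence on that whole line. Continuity then gives ψ = 0 on a real ball. -/
lemma isDetermining_of_hasDeepZero {d : ℕ} {s : RSpace d → ℝ≥0∞} (hs : Measurable s)
    (h : HasDeepZero s) : IsDetermining s := by
  intro ψ hψ hfin
  obtain ⟨u₀, hu₀⟩ := h
  set f : RSpace d → ℝ≥0∞ := fun u => ‖ψ (complexify u)‖ₑ ^ 2 with hf
  have hψc : Continuous fun u : RSpace d => ψ (complexify u) :=
    hψ.continuous.comp continuous_complexify
  have hfm : Measurable f := (hψc.measurable.enorm.pow_const 2)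
  have hfs : Measurable fun u => f u / s u := hfm.div hs
  set J := ∫⁻ u : RSpace d, f u / s u with hJ
  have hJfin : J < ∞ := hfin
  have hbd : ∀ k : ℕ, ∃ C ε : ℝ, 0 < ε ∧ ∀ r : ℝ, 0 < r → r < ε →
      ∫⁻ u in Metric.ball u₀ r, f u ≤ ENNReal.ofReal (C * r ^ k) * J := by
    intro k
    obtain ⟨C, ε, hε, hC⟩ := hu₀ k
    refine ⟨|C|, ε, hε, fun r hr hrε => ?_⟩
    rw [hJ, ← lintegral_const_mul _ hfs]
    refine le_trans ?_ (setLIntegral_le_lintegral (Metric.ball u₀ r) _)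
    refine lintegral_mono_ae ?_
    filter_upwards [ae_restrict_mem Metric.isOpen_ball.measurableSet, ae_restrict_of_ae hC,
      ae_restrict_of_ae (ae_lt_top hfs hJfin.ne)] with u hu hCu hlt
    rw [mem_ball_iff_norm] at hu
    have hs1 : s u ≤ ENNReal.ofReal (|C| * r ^ k) := by
      refine (hCu (hu.trans hrε)).trans (ENNReal.ofReal_le_ofReal ?_)
      exact mul_le_mul (le_abs_self C) (pow_le_pow_left₀ (norm_nonneg _) hu.le k)
        (by positivity) (abs_nonneg C)
    have hs2 : s u ≠ ∞ := (hs1.trans_lt ENNReal.ofReal_lt_top).ne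
    -- Where s vanishes, finiteness of f/s forces f = 0, so the identity survives division by zero.
    calc f u = s u * (f u / s u) := by
          refine (ENNReal.mul_div_cancel' (fun h0 => ?_) fun h0 => absurd h0 hs2).symm
          by_contra hne
          rw [h0, ENNReal.div_zero hne] at hlt
          exact lt_irrefl _ hlt
      _ ≤ _ := by gcongr
  have hlim : ∀ N : ℕ, ∀ᵐ v ∂(volume.restrict (Metric.ball (0 : RSpace d) 1)),
      liminf (fun n : ℕ => ((n + 1 : ℕ) : ℝ≥0∞) ^ N * f (u₀ + ((n + 1 : ℕ) : ℝ)⁻¹ • v)) atTop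
        = 0 := by
    intro N
    have hm : ∀ n : ℕ, Measurable fun v : RSpace d =>
        ((n + 1 : ℕ) : ℝ≥0∞) ^ N * f (u₀ + ((n + 1 : ℕ) : ℝ)⁻¹ • v) := fun n =>
      (hfm.comp (by fun_prop)).const_mul _
    have hle := lintegral_liminf_le (μ := volume.restrict (Metric.ball (0 : RSpace d) 1))
      (u := atTop) hm
    -- N powers of the radius absorb the weight, d absorb the Jacobian, and one is left to tend to
    -- 0.
    obtain ⟨C, ε, hε, hC⟩ := hbd (N + d + 1)
    have h1 : Tendsto (fun n : ℕ => (((n + 1 : ℕ) : ℝ)⁻¹ : ℝ)) atTop (𝓝 0) := by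
      have := tendsto_one_div_add_atTop_nhds_zero_nat (𝕜 := ℝ)
      simpa using this
    have h2 : Tendsto (fun n : ℕ => ENNReal.ofReal (C * ((n + 1 : ℕ) : ℝ)⁻¹) * J) atTop
        (𝓝 0) := by
      have h3 := ENNReal.tendsto_ofReal (h1.const_mul C)
      have h4 := ENNReal.Tendsto.mul_const (b := J) h3 (Or.inr hJfin.ne)
      simpa using h4
    have h0 : Tendsto (fun n : ℕ => ∫⁻ v in Metric.ball (0 : RSpace d) 1,
        ((n + 1 : ℕ) : ℝ≥0∞) ^ N * f (u₀ + ((n + 1 : ℕ) : ℝ)⁻¹ • v)) atTop (𝓝 0) := by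
      refine tendsto_of_tendsto_of_tendsto_of_le_of_le' tendsto_const_nhds h2
        (Eventually.of_forall fun n => zero_le) ?_
      filter_upwards [h1.eventually (gt_mem_nhds hε)] with n hn
      rw [lintegral_const_mul _ (show Measurable fun v : RSpace d =>
        f (u₀ + ((n + 1 : ℕ) : ℝ)⁻¹ • v) from hfm.comp (by fun_prop)), lintegral_ball_comp_scale hfm,
        ← mul_assoc, ← pow_add]
      refine (mul_le_mul_right (hC _ (by positivity) hn) _).trans ?_
      rw [← mul_assoc]
      refine mul_le_mul_left (le_of_eq ?_) J
      rw [← ENNReal.ofReal_natCast, ← ENNReal.ofReal_pow (by positivity),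
        ← ENNReal.ofReal_mul (by positivity)]
      congr 1
      have hn0 : ((n + 1 : ℕ) : ℝ) ≠ 0 := by positivity
      rw [inv_pow, pow_succ]
      field_simp
    rw [h0.liminf_eq] at hle
    exact (lintegral_eq_zero_iff (Measurable.liminf hm)).1 (le_antisymm hle zero_le)
  have hae : (fun v : RSpace d => ψ (complexify (u₀ + v)))
      =ᵐ[volume.restrict (Metric.ball (0 : RSpace d) 1)] fun _ => 0 := by
    filter_upwards [ae_all_iff.2 hlim] with v hv
    have := entire_eq_zero_of_liminf
      (differentiable_along_line hψ (complexify u₀) (complexify v)) fun N => by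
        simp only [← complexify_add_smul]
        exact hv N
    have := congrFun this ((1 : ℝ) : ℂ)
    simpa only [← complexify_add_smul, one_smul, Pi.zero_apply] using this
  refine entire_eq_zero_of_real_ball hψ u₀ one_pos fun v hv => ?_
  exact Measure.eqOn_open_of_ae_eq hae Metric.isOpen_ball
    (hψc.comp (by fun_prop : Continuous fun v : RSpace d => u₀ + v)).continuousOn
    continuousOn_const (mem_ball_zero_iff.2 hv)

/-- In one variable ψ ≠ 0 has a finite order m at u₀, so |ψ(u)| ≥ c ‖u - u₀‖^m nearby, and ∫ |ψ|²/s
dominates a multiple of the divergent integral with exponent 2m. -/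
lemma isDetermining_of_hasIntegralDeepZero {s : RSpace 1 → ℝ≥0∞}
    (h : HasIntegralDeepZero s) : IsDetermining s := by
  intro ψ hψ hfin
  obtain ⟨u₀, hu₀⟩ := h
  by_contra hne
  set g : ℂ → ℂ := fun t => ψ (complexify u₀ + t • fun _ => 1) with hg
  have hgd : Differentiable ℂ g := differentiable_along_line hψ _ _
  have hval : ∀ u : RSpace 1, complexify u = complexify u₀ + (((u 0 - u₀ 0 : ℝ)) : ℂ) •
      fun _ => (1 : ℂ) := by
    intro u; ext i; fin_cases i; simp [complexify]
  have hg0 : g ≠ 0 := by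
    intro h0
    refine hne (entire_eq_zero_of_real_ball hψ u₀ one_pos fun v _ => ?_)
    rw [hval]
    exact congrFun h0 _
  obtain ⟨m, k, hk, hk0, heq⟩ := exists_order_of_entire hgd hg0
  set c := ‖k 0‖ / 2 with hc
  have hkpos : 0 < ‖k 0‖ := norm_pos_iff.2 hk0
  have hcpos : 0 < c := by positivity
  have hev : ∀ᶠ z in 𝓝 (0 : ℂ), g z = z ^ m * k z ∧ c < ‖k z‖ :=
    heq.and (hk.norm.eventually (lt_mem_nhds (by simp only [hc]; linarith)))
  obtain ⟨ε, hε, hball⟩ := Metric.eventually_nhds_iff.1 hev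
  have hcon := hu₀ (2 * m) ε hε
  have hnorm : ∀ u : RSpace 1, |u 0 - u₀ 0| = ‖u - u₀‖ := by
    intro u
    simp [EuclideanSpace.norm_eq, Real.sqrt_sq_eq_abs]
  have hle : ∫⁻ u in Metric.ball u₀ ε, ‖u - u₀‖ₑ ^ (2 * m) / s u ≤
      ∫⁻ u : RSpace 1, ENNReal.ofReal (c⁻¹ ^ 2) * (‖ψ (complexify u)‖ₑ ^ 2 / s u) := by
    refine (setLIntegral_mono' Metric.isOpen_ball.measurableSet fun u hu => ?_).trans
      (setLIntegral_le_lintegral (Metric.ball u₀ ε) _)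
    rw [mem_ball_iff_norm] at hu
    rw [← mul_div_assoc]
    refine ENNReal.div_le_div_right ?_ _
    have hz := hball (y := ((u 0 - u₀ 0 : ℝ) : ℂ)) (by
      rw [dist_zero_right, Complex.norm_real, Real.norm_eq_abs, hnorm]; exact hu)
    have hψu : ‖ψ (complexify u)‖ = ‖u - u₀‖ ^ m * ‖k ((u 0 - u₀ 0 : ℝ) : ℂ)‖ := by
      rw [hval, ← hnorm, ← Real.norm_eq_abs, ← Complex.norm_real, ← norm_pow, ← norm_mul]
      exact congrArg _ hz.1
    rw [← ofReal_norm, ← ofReal_norm, ← ENNReal.ofReal_pow (norm_nonneg _),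
      ← ENNReal.ofReal_pow (norm_nonneg _), ← ENNReal.ofReal_mul (by positivity)]
    refine ENNReal.ofReal_le_ofReal ?_
    rw [hψu, mul_pow, ← pow_mul, mul_comm m 2]
    have : 1 ≤ c⁻¹ ^ 2 * ‖k ((u 0 - u₀ 0 : ℝ) : ℂ)‖ ^ 2 := by
      rw [← mul_pow]
      refine one_le_pow₀ ?_
      rw [inv_mul_eq_div, one_le_div hcpos]
      exact hz.2.le
    nlinarith [pow_nonneg (norm_nonneg (u - u₀)) (2 * m)]
  rw [hcon, lintegral_const_mul' _ _ ENNReal.ofReal_ne_top] at hle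
  exact (ENNReal.mul_lt_top ENNReal.ofReal_lt_top hfin).ne (top_le_iff.1 hle)

/-! ### Complex measures, test functions and almost sure linearity of M -/

/-- Finite variation makes every test function integrable against a realisation of M, which
additivity of the integral requires. -/
instance ComplexMeasure.isFiniteMeasure_variation {X : Type*} [MeasurableSpace X]
    (ν : ComplexMeasure X) : IsFiniteMeasure ν.variation := by
  have h : ν.variation ≤ (ComplexMeasure.re ν).totalVariation
      + (ComplexMeasure.im ν).totalVariation := by
    refine VectorMeasure.variation_le_of_forall_enorm_le fun E _ => ?_
    rw [Measure.add_apply]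
    calc ‖ν E‖ₑ = ‖((ν E).re : ℂ) + ((ν E).im : ℂ) * Complex.I‖ₑ := by rw [Complex.re_add_im]
      _ ≤ ‖((ν E).re : ℂ)‖ₑ + ‖((ν E).im : ℂ) * Complex.I‖ₑ := enorm_add_le _ _
      _ = ‖ComplexMeasure.re ν E‖ₑ + ‖ComplexMeasure.im ν E‖ₑ := by
          have h1 : ComplexMeasure.re ν E = (ν E).re := rfl
          have h2 : ComplexMeasure.im ν E = (ν E).im := rfl
          rw [h1, h2]
          simp [← ofReal_norm]
      _ ≤ _ := add_le_add (SignedMeasure.enorm_le_totalVariation _ E)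
          (SignedMeasure.enorm_le_totalVariation _ E)
  exact isFiniteMeasure_of_le _ h

/-- The pairing is only declared real bilinear, so complex homogeneity is checked on its values. -/
lemma VectorMeasure.integral_const_mul_complex {X : Type*} [MeasurableSpace X]
    (ν : ComplexMeasure X) (c : ℂ) (f : X → ℂ) :
    VectorMeasure.integral ν (c • f) (ContinuousLinearMap.mul ℝ ℂ) =
      c • VectorMeasure.integral ν f (ContinuousLinearMap.mul ℝ ℂ) := by
  rw [VectorMeasure.integral_eq_setToFun, VectorMeasure.integral_eq_setToFun]
  refine setToFun_smul _ (fun c s x => ?_) c f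
  change (c * x) * ν s = c * (x * ν s)
  ring

lemma lintegral_enorm_sq_eq_eLpNorm_sq {X : Type*} [MeasurableSpace X] {μ : Measure X}
    (f : X → ℂ) : ∫⁻ x, ‖f x‖ₑ ^ 2 ∂μ = eLpNorm f 2 μ ^ 2 := by
  rw [eLpNorm_eq_lintegral_rpow_enorm_toReal two_ne_zero ENNReal.ofNat_ne_top]
  simp only [ENNReal.toReal_ofNat, one_div]
  rw [← ENNReal.rpow_natCast, ← ENNReal.rpow_mul]
  simp

namespace IsTestFn

variable {d : ℕ} {f g : RSpace d → ℂ}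

lemma zero : IsTestFn (0 : RSpace d → ℂ) :=
  ⟨measurable_zero, ⟨0, by simp⟩, HasCompactSupport.zero⟩

lemma add (hf : IsTestFn f) (hg : IsTestFn g) : IsTestFn (f + g) := by
  obtain ⟨C, hC⟩ := hf.bounded
  obtain ⟨D, hD⟩ := hg.bounded
  exact ⟨hf.measurable.add hg.measurable,
    ⟨C + D, fun x => (norm_add_le _ _).trans (add_le_add (hC x) (hD x))⟩,
    hf.compactSupport.add hg.compactSupport⟩

lemma smul (c : ℂ) (hf : IsTestFn f) : IsTestFn (c • f) := by
  obtain ⟨C, hC⟩ := hf.bounded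
  refine ⟨hf.measurable.const_smul c, ⟨‖c‖ * C, fun x => ?_⟩,
    hf.compactSupport.smul_left (f := fun _ => c)⟩
  rw [Pi.smul_apply, norm_smul]
  exact mul_le_mul_of_nonneg_left (hC x) (norm_nonneg c)

lemma sub (hf : IsTestFn f) (hg : IsTestFn g) : IsTestFn (f - g) := by
  have := hf.add (hg.smul (-1))
  rwa [neg_one_smul, ← sub_eq_add_neg] at this

lemma translate (x : RSpace d) (hf : IsTestFn f) : IsTestFn (translateFn x f) := by
  obtain ⟨C, hC⟩ := hf.bounded
  refine ⟨hf.measurable.comp (by fun_prop), ⟨C, fun y => hC _⟩, ?_⟩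
  exact hf.compactSupport.comp_homeomorph (Homeomorph.subRight x)

lemma integrable_of_isFiniteMeasureOnCompacts {μ : Measure (RSpace d)}
    [IsFiniteMeasureOnCompacts μ] (hf : IsTestFn f) : Integrable f μ := by
  obtain ⟨C, hC⟩ := hf.bounded
  have hi : IntegrableOn f (tsupport f) μ :=
    Measure.integrableOn_of_bounded (IsCompact.measure_lt_top hf.compactSupport).ne
      hf.measurable.aestronglyMeasurable (Eventually.of_forall hC)
  rwa [integrableOn_iff_integrable_of_support_subset (subset_tsupport f)] at hi

end IsTestFn

/-- The test functions living on `B`, as a vector space. -/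
def testFnOn {d : ℕ} (B : Set (RSpace d)) : Submodule ℂ (RSpace d → ℂ) where
  carrier := {f | IsTestFnOn B f}
  zero_mem' := ⟨IsTestFn.zero, fun _ _ => rfl⟩
  add_mem' {f g} hf hg := ⟨hf.toIsTestFn.add hg.toIsTestFn, fun x hx => by
    simp [hf.zero_off x hx, hg.zero_off x hx]⟩
  smul_mem' c f hf := ⟨hf.toIsTestFn.smul c, fun x hx => by simp [hf.zero_off x hx]⟩

namespace IsWeaklyStationaryRandomMeasure

variable {d : ℕ} {Ω : Type*} [MeasurableSpace Ω] {P : Measure Ω} {M : (RSpace d → ℂ) → Ω → ℂ}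
  {f g : RSpace d → ℂ}

/-- Linearity of M is not assumed: it holds almost surely because one complex measure represents M
on a compact set containing both supports. -/
lemma add_ae_eq (hM : IsWeaklyStationaryRandomMeasure P M) (hf : IsTestFn f) (hg : IsTestFn g) :
    M (f + g) =ᵐ[P] M f + M g := by
  filter_upwards [hM.ae_measure] with ω hω
  obtain ⟨ν, hν⟩ := hω (tsupport f ∪ tsupport g) (hf.compactSupport.union hg.compactSupport)
  have hf0 : ∀ x, x ∉ tsupport f ∪ tsupport g → f x = 0 := fun x hx =>
    image_eq_zero_of_notMem_tsupport fun h => hx (Or.inl h)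
  have hg0 : ∀ x, x ∉ tsupport f ∪ tsupport g → g x = 0 := fun x hx =>
    image_eq_zero_of_notMem_tsupport fun h => hx (Or.inr h)
  rw [Pi.add_apply, hν f ⟨hf, hf0⟩, hν g ⟨hg, hg0⟩,
    hν (f + g) ⟨hf.add hg, fun x hx => by simp [hf0 x hx, hg0 x hx]⟩]
  exact VectorMeasure.integral_add hf.integrable_of_isFiniteMeasureOnCompacts
    hg.integrable_of_isFiniteMeasureOnCompacts

lemma smul_ae_eq (hM : IsWeaklyStationaryRandomMeasure P M) (c : ℂ) (hf : IsTestFn f) :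
    M (c • f) =ᵐ[P] c • M f := by
  filter_upwards [hM.ae_measure] with ω hω
  obtain ⟨ν, hν⟩ := hω (tsupport f) hf.compactSupport
  have hf0 : ∀ x, x ∉ tsupport f → f x = 0 := fun x hx => image_eq_zero_of_notMem_tsupport hx
  rw [Pi.smul_apply, hν f ⟨hf, hf0⟩, hν (c • f) ⟨hf.smul c, fun x hx => by simp [hf0 x hx]⟩]
  exact VectorMeasure.integral_const_mul_complex ν c f

lemma sub_ae_eq (hM : IsWeaklyStationaryRandomMeasure P M) (hf : IsTestFn f) (hg : IsTestFn g) :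
    M (f - g) =ᵐ[P] M f - M g := by
  have h1 := hM.add_ae_eq (hf.sub hg) hg
  rw [sub_add_cancel] at h1
  filter_upwards [h1] with ω h
  simp [h]

lemma mean_smul (hM : IsWeaklyStationaryRandomMeasure P M) (c : ℂ) (hf : IsTestFn f) :
    ∫ ω, M (c • f) ω ∂P = c * ∫ ω, M f ω ∂P := by
  rw [integral_congr_ae (hM.smul_ae_eq c hf)]
  exact integral_const_mul c (M f)

lemma complexVar_eq_eLpNorm_centred_sq (f : RSpace d → ℂ) :
    complexVar P (M f) = eLpNorm (centred P M f) 2 P ^ 2 :=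
  lintegral_enorm_sq_eq_eLpNorm_sq _

variable [IsProbabilityMeasure P]

lemma integrable (hM : IsWeaklyStationaryRandomMeasure P M) (hf : IsTestFn f) :
    Integrable (M f) P :=
  (hM.memLp f hf).integrable one_le_two

lemma mean_add (hM : IsWeaklyStationaryRandomMeasure P M) (hf : IsTestFn f) (hg : IsTestFn g) :
    ∫ ω, M (f + g) ω ∂P = ∫ ω, M f ω ∂P + ∫ ω, M g ω ∂P := by
  rw [integral_congr_ae (hM.add_ae_eq hf hg)]
  exact integral_add (hM.integrable hf) (hM.integrable hg)

lemma mean_sub (hM : IsWeaklyStationaryRandomMeasure P M) (hf : IsTestFn f) (hg : IsTestFn g) :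
    ∫ ω, M (f - g) ω ∂P = ∫ ω, M f ω ∂P - ∫ ω, M g ω ∂P := by
  rw [integral_congr_ae (hM.sub_ae_eq hf hg)]
  exact integral_sub (hM.integrable hf) (hM.integrable hg)

lemma memLp_centred (hM : IsWeaklyStationaryRandomMeasure P M) (hf : IsTestFn f) :
    MemLp (centred P M f) 2 P :=
  (hM.memLp f hf).sub (memLp_const _)

lemma complexVar_lt_top (hM : IsWeaklyStationaryRandomMeasure P M) (hf : IsTestFn f) :
    complexVar P (M f) < ∞ := by
  rw [complexVar_eq_eLpNorm_centred_sq]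
  exact ENNReal.pow_lt_top (hM.memLp_centred hf).2

lemma centred_sub_ae_eq (hM : IsWeaklyStationaryRandomMeasure P M) (hf : IsTestFn f)
    (hg : IsTestFn g) : centred P M (f - g) =ᵐ[P] centred P M f - centred P M g := by
  filter_upwards [hM.sub_ae_eq hf hg] with ω h
  simp only [centred, Pi.sub_apply, h, hM.mean_sub hf hg]
  ring

end IsWeaklyStationaryRandomMeasure

/-! ### Fourier transforms of test functions and local finiteness of the spectral measure -/

section Fourier

variable {d : ℕ} {f g : RSpace d → ℂ}

lemma exp_neg_I_mul_ofReal (t : ℝ) :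
    Complex.exp (-(Complex.I * (t : ℂ))) = (Real.probChar (-t) : ℂ) := by
  rw [Real.probChar_apply]
  congr 1
  push_cast
  ring

lemma fourierHat_eq (f : RSpace d → ℂ) : fourierHat f =
    VectorFourier.fourierIntegral Real.probChar volume (innerₗ (RSpace d)) f := by
  ext u
  simp only [fourierHat, VectorFourier.fourierIntegral, exp_neg_I_mul_ofReal, Circle.smul_def,
    smul_eq_mul, innerₗ_apply_apply, real_inner_comm]

lemma continuous_innerₗ_uncurried :
    Continuous fun p : RSpace d × RSpace d => innerₗ (RSpace d) p.1 p.2 := by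
  simp only [innerₗ_apply_apply]; fun_prop

lemma continuous_fourierHat (hf : IsTestFn f) : Continuous (fourierHat f) := by
  rw [fourierHat_eq]
  exact VectorFourier.fourierIntegral_continuous Real.continuous_probChar
    continuous_innerₗ_uncurried hf.integrable_of_isFiniteMeasureOnCompacts

lemma norm_fourierHat_le (f : RSpace d → ℂ) (u : RSpace d) : ‖fourierHat f u‖ ≤ ∫ x, ‖f x‖ := by
  rw [fourierHat_eq]
  exact VectorFourier.norm_fourierIntegral_le_integral_norm _ _ _ _ _

lemma fourierHat_add (hf : IsTestFn f) (hg : IsTestFn g) :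
    fourierHat (f + g) = fourierHat f + fourierHat g := by
  simp only [fourierHat_eq]
  exact VectorFourier.fourierIntegral_add Real.continuous_probChar continuous_innerₗ_uncurried
    hf.integrable_of_isFiniteMeasureOnCompacts hg.integrable_of_isFiniteMeasureOnCompacts

lemma fourierHat_smul (c : ℂ) (f : RSpace d → ℂ) :
    fourierHat (c • f) = c • fourierHat f := by
  simp only [fourierHat_eq]
  exact VectorFourier.fourierIntegral_const_smul _ _ _ _ _

lemma fourierHat_sub (hf : IsTestFn f) (hg : IsTestFn g) :
    fourierHat (f - g) = fourierHat f - fourierHat g := by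
  have h := fourierHat_add (hf.sub hg) hg
  rw [sub_add_cancel] at h
  rw [h, add_sub_cancel_right]

lemma fourierHat_translateFn (x : RSpace d) (f : RSpace d → ℂ) (u : RSpace d) :
    fourierHat (translateFn x f) u = Complex.exp (-(Complex.I * ((inner ℝ u x : ℝ) : ℂ))) *
      fourierHat f u := by
  unfold fourierHat translateFn
  rw [← integral_add_right_eq_self _ x, ← integral_const_mul]
  refine integral_congr_ae (Eventually.of_forall fun y => ?_)
  simp only [add_sub_cancel_right]
  rw [← mul_assoc, ← Complex.exp_add, inner_add_right]
  congr 2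
  push_cast
  ring

/-- Around each frequency there is a test function with nonvanishing Fourier transform. -/
lemma exists_fourierHat_ne_zero (u₀ : RSpace d) :
    ∃ f : RSpace d → ℂ, IsTestFn f ∧ fourierHat f u₀ ≠ 0 := by
  set B := Metric.closedBall (0 : RSpace d) 1 with hB
  -- At u₀ the modulation cancels the Fourier kernel, leaving the volume of the ball.
  refine ⟨B.indicator fun x => Complex.exp (Complex.I * ((inner ℝ u₀ x : ℝ) : ℂ)),
    ⟨?_, ⟨1, fun x => ?_⟩, ?_⟩, ?_⟩
  · exact (by fun_prop : Continuous fun x : RSpace d =>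
      Complex.exp (Complex.I * ((inner ℝ u₀ x : ℝ) : ℂ))).measurable.indicator
        Metric.isClosed_closedBall.measurableSet
  · refine (norm_indicator_le_norm_self _ _).trans ?_
    rw [mul_comm, Complex.norm_exp_ofReal_mul_I]
  · exact HasCompactSupport.intro (isCompact_closedBall 0 1) fun x hx =>
      Set.indicator_of_notMem hx _
  · have h : fourierHat (B.indicator fun x => Complex.exp (Complex.I * ((inner ℝ u₀ x : ℝ) : ℂ))) u₀
        = ∫ x in B, (1 : ℂ) := by
      rw [← integral_indicator Metric.isClosed_closedBall.measurableSet]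
      refine integral_congr_ae (Eventually.of_forall fun x => ?_)
      by_cases hx : x ∈ B
      · simp only [Set.indicator_of_mem hx, ← Complex.exp_add, neg_add_cancel, Complex.exp_zero]
        exact (Set.indicator_of_mem hx (fun _ : RSpace d => (1 : ℂ))).symm
      · simp only [Set.indicator_of_notMem hx, mul_zero]
        exact (Set.indicator_of_notMem hx (fun _ : RSpace d => (1 : ℂ))).symm
    rw [h, setIntegral_const]
    have : 0 < volume.real B := by
      rw [measureReal_def]
      exact ENNReal.toReal_pos (Metric.measure_closedBall_pos volume 0 one_pos).ne'
        measure_closedBall_lt_top.ne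
    simpa using this.ne'

/-- Chebyshev's inequality for |f̂|², with f chosen so that |f̂|² is bounded below near the given
point. -/
lemma isLocallyFiniteMeasure_of_lintegral_fourierHat_lt_top {S : Measure (RSpace d)}
    (hS : ∀ f, IsTestFn f → ∫⁻ u, ‖fourierHat f u‖ₑ ^ 2 ∂S < ∞) : IsLocallyFiniteMeasure S := by
  refine ⟨fun u₀ => ?_⟩
  obtain ⟨f, hf, hne⟩ := exists_fourierHat_ne_zero u₀
  have hpos : 0 < ‖fourierHat f u₀‖ₑ ^ 2 := ENNReal.pow_pos (enorm_pos.2 hne) 2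
  obtain ⟨c, hc0, hc⟩ := exists_between hpos
  have hcont : Continuous fun u => ‖fourierHat f u‖ₑ ^ 2 :=
    (ENNReal.continuous_pow 2).comp (continuous_fourierHat hf).enorm
  refine ⟨{u | c ≤ ‖fourierHat f u‖ₑ ^ 2}, ?_, ?_⟩
  · filter_upwards [hcont.continuousAt.eventually (lt_mem_nhds hc)] with u hu using hu.le
  · exact (meas_ge_le_lintegral_div hcont.measurable.aemeasurable hc0.ne'
      (hc.trans_le le_top).ne).trans_lt (ENNReal.div_lt_top (hS f hf).ne hc0.ne')

end Fourier

lemma IsSpectralMeasure.lintegral_lt_top {d : ℕ} {Ω : Type*} [MeasurableSpace Ω] {P : Measure Ω}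
    [IsProbabilityMeasure P] {M : (RSpace d → ℂ) → Ω → ℂ} {S : Measure (RSpace d)}
    (hM : IsWeaklyStationaryRandomMeasure P M) (hS : IsSpectralMeasure P M S)
    {f : RSpace d → ℂ} (hf : IsTestFn f) : ∫⁻ u, ‖fourierHat f u‖ₑ ^ 2 ∂S < ∞ := by
  have h := hM.complexVar_lt_top hf
  rw [hS f hf] at h
  exact ENNReal.lt_top_of_mul_ne_top_right h.ne
    (ENNReal.ofReal_pos.2 (by positivity)).ne'

/-! ### Paley–Wiener: compactly supported transforms have entire densities -/

section PaleyWiener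

open scoped FourierTransform SchwartzMap ContDiff

variable {d : ℕ}

/-- The Fourier–Laplace transform of a continuous compactly supported function is entire. -/
lemma differentiable_fourierLaplace {F : RSpace d → ℂ} (hF : Continuous F)
    (hFc : HasCompactSupport F) : Differentiable ℂ fun z : Fin d → ℂ =>
      ∫ x : RSpace d, Complex.exp (Complex.I * ∑ j, z j * (x j : ℂ)) * F x := by
  intro z₀
  set Λ : RSpace d → ((Fin d → ℂ) →L[ℂ] ℂ) := fun x =>
    Complex.I • ∑ j, (x j : ℂ) • ContinuousLinearMap.proj (R := ℂ) (φ := fun _ : Fin d => ℂ) j with hΛ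
  have hΛc : Continuous Λ := by
    have h : ∀ j, Continuous fun x : RSpace d => (x j : ℂ) • ContinuousLinearMap.proj (R := ℂ)
        (φ := fun _ : Fin d => ℂ) j := fun j =>
      (by fun_prop : Continuous fun x : RSpace d => (x j : ℂ)).smul continuous_const
    exact (continuous_finsetSum _ fun j _ => h j).const_smul Complex.I
  have hΛz : ∀ (x : RSpace d) (z : Fin d → ℂ), Λ x z = Complex.I * ∑ j, z j * (x j : ℂ) := by
    intro x z
    simp [hΛ, mul_comm]
  set F' : (Fin d → ℂ) → RSpace d → ((Fin d → ℂ) →L[ℂ] ℂ) := fun z x =>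
    (Complex.exp (Λ x z) * F x) • Λ x with hF'
  have hF'c : Continuous fun p : (Fin d → ℂ) × RSpace d => F' p.1 p.2 := by
    simp only [hF']
    fun_prop
  obtain ⟨C, hC⟩ := ((isCompact_closedBall z₀ 1).prod hFc).exists_bound_of_continuousOn
    hF'c.continuousOn
  have hcont : ∀ z : Fin d → ℂ, Continuous fun x => Complex.exp (Λ x z) * F x := by
    intro z; fun_prop
  have key := hasFDerivAt_integral_of_dominated_of_fderiv_le (𝕜 := ℂ) (μ := volume)
    (F := fun z (x : RSpace d) => Complex.exp (Λ x z) * F x) (F' := F') (x₀ := z₀)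
    (s := Metric.closedBall z₀ 1) (bound := (tsupport F).indicator fun _ => C)
    (Metric.closedBall_mem_nhds z₀ one_pos)
    (Eventually.of_forall fun z => (hcont z).aestronglyMeasurable)
    ((hcont z₀).integrable_of_hasCompactSupport hFc.mul_left)
    ((hF'c.comp (by fun_prop : Continuous fun x : RSpace d => (z₀, x))).aestronglyMeasurable)
    (Eventually.of_forall fun x z hz => by
      by_cases hx : x ∈ tsupport F
      · rw [Set.indicator_of_mem hx]
        exact hC (z, x) ⟨hz, hx⟩
      · rw [Set.indicator_of_notMem hx]
        simp [hF', image_eq_zero_of_notMem_tsupport hx])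
    ((integrable_indicator_iff (isClosed_tsupport F).measurableSet).2
      (integrableOn_const (IsCompact.measure_lt_top hFc).ne))
    (Eventually.of_forall fun x z _ => by
      have h := ((Λ x).hasFDerivAt (x := z)).cexp.mul_const (F x)
      refine h.congr_fderiv ?_
      rw [smul_smul, mul_comm])
  have := key.differentiableAt
  simpa only [hΛz] using this

lemma ae_lt_top_of_isLocallyFiniteMeasure_withDensity {s : RSpace d → ℝ≥0∞} (hs : Measurable s)
    [IsLocallyFiniteMeasure ((volume : Measure (RSpace d)).withDensity s)] :
    ∀ᵐ u ∂(volume : Measure (RSpace d)), s u < ⊤ := by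
  have h : ∀ n : ℕ, ∀ᵐ u ∂(volume : Measure (RSpace d)),
      u ∈ Metric.closedBall (0 : RSpace d) n → s u < ⊤ := by
    intro n
    rw [← ae_restrict_iff' Metric.isClosed_closedBall.measurableSet]
    refine ae_lt_top hs ?_
    rw [← withDensity_apply _ Metric.isClosed_closedBall.measurableSet]
    exact (isCompact_closedBall (0 : RSpace d) n).measure_lt_top.ne
  filter_upwards [ae_all_iff.2 h] with u hu
  obtain ⟨n, hn⟩ := exists_nat_ge ‖u‖
  exact hu n (mem_closedBall_zero_iff.2 hn)

lemma fourierIntegral_probChar_eq_fourier (η : RSpace d → ℂ) (u : RSpace d) :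
    VectorFourier.fourierIntegral Real.probChar volume (innerₗ (RSpace d)) η u =
      𝓕 η ((2 * Real.pi)⁻¹ • u) := by
  rw [VectorFourier.fourierIntegral_probChar, Real.fourier_eq']
  refine integral_congr_ae (Eventually.of_forall fun x => ?_)
  simp only [innerₗ_apply_apply, inner_smul_right]
  congr 2
  have : Real.pi ≠ 0 := Real.pi_ne_zero
  push_cast
  field_simp

/-- If `k dS + b δ₀` has an integrable Fourier transform `F`, then, away from the origin, it is
weakly equal to the function given by Fourier inversion. -/
lemma integral_smul_eq_of_fourier {S : Measure (RSpace d)} [IsLocallyFiniteMeasure S]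
    {k : RSpace d → ℂ} (hk : Integrable k S) {b : ℂ} {F : RSpace d → ℂ} (hFi : Integrable F)
    (hF : ∀ x, F x = VectorFourier.fourierIntegral Real.probChar S (innerₗ (RSpace d)) k x + b)
    {g : RSpace d → ℝ} (hg : ContDiff ℝ ∞ g) (hgc : HasCompactSupport g) (hg0 : g 0 = 0) :
    ∫ u, g u • k u ∂S =
      ∫ u, g u • (((2 * Real.pi) ^ d)⁻¹ • 𝓕⁻ F ((2 * Real.pi)⁻¹ • u)) := by
  have hpi : (0 : ℝ) < 2 * Real.pi := by positivity
  -- The dilation by 2π reconciles the kernel exp(-i u·x) with that of `𝓕`; η then has transform g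
  -- in the former convention. F is paired with η in two ways.
  set θ₀ : RSpace d → ℂ := fun w => (g ((2 * Real.pi) • w) : ℂ) with hθ₀
  have hθd : ContDiff ℝ ∞ θ₀ :=
    Complex.ofRealCLM.contDiff.comp (hg.comp (contDiff_const_smul _))
  have hθc : HasCompactSupport θ₀ :=
    (hgc.comp_homeomorph (Homeomorph.smulOfNeZero (2 * Real.pi) hpi.ne')).comp_left
      (g := fun r : ℝ => (r : ℂ)) (by simp)
  set θ : 𝓢(RSpace d, ℂ) := hθc.toSchwartzMap hθd with hθ
  set η : 𝓢(RSpace d, ℂ) := 𝓕⁻ θ with hη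
  have hηθ : 𝓕 (η : RSpace d → ℂ) = θ₀ := by
    rw [← SchwartzMap.fourier_coe, hη, FourierTransform.fourier_fourierInv_eq]
    rfl
  have hηc : (η : RSpace d → ℂ) = 𝓕⁻ θ₀ := by
    rw [hη, SchwartzMap.fourierInv_coe]
    rfl
  have hηi : Integrable (η : RSpace d → ℂ) := η.integrable
  have hθi : Integrable θ₀ := hθd.continuous.integrable_of_hasCompactSupport hθc
  have e1 : ∫ x, F x * η x = ∫ u, g u • k u ∂S := by
    have hflip := VectorFourier.integral_fourierIntegral_smul_eq_flip (μ := S) (ν := volume)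
      (L := innerₗ (RSpace d)) Real.continuous_probChar continuous_innerₗ_uncurried hk hηi
    rw [flip_innerₗ] at hflip
    -- Since g(0) = 0, η has mean zero and the constant b drops out.
    have hη0 : ∫ x, η x = 0 := by
      have := congrFun hηθ 0
      rw [Real.fourier_eq'] at this
      simpa [hθ₀, hg0] using this
    have hconv : Integrable fun x =>
        VectorFourier.fourierIntegral Real.probChar S (innerₗ (RSpace d)) k x • η x := by
      refine hηi.bdd_mul (c := ∫ u, ‖k u‖ ∂S) ?_ (Eventually.of_forall fun x => ?_)
      · exact (VectorFourier.fourierIntegral_continuous Real.continuous_probChar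
          continuous_innerₗ_uncurried hk).aestronglyMeasurable
      · exact VectorFourier.norm_fourierIntegral_le_integral_norm _ _ _ _ _
    calc ∫ x, F x * η x
        = ∫ x, (VectorFourier.fourierIntegral Real.probChar S (innerₗ (RSpace d)) k x • η x
            + b * η x) := by
          refine integral_congr_ae (Eventually.of_forall fun x => ?_)
          simp only [hF x, smul_eq_mul]
          ring
      _ = ∫ u, k u • VectorFourier.fourierIntegral Real.probChar volume (innerₗ (RSpace d)) η u
            ∂S := by
          rw [integral_add hconv (hηi.const_mul b), integral_const_mul, hη0, mul_zero, add_zero,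
            hflip]
      _ = _ := by
          refine integral_congr_ae (Eventually.of_forall fun u => ?_)
          simp only [fourierIntegral_probChar_eq_fourier, hηθ, hθ₀, smul_smul,
            mul_inv_cancel₀ hpi.ne', one_smul, smul_eq_mul, Complex.real_smul]
          ring
  have e2 : ∫ x, F x * η x = ∫ w, 𝓕⁻ F w * θ₀ w := by
    -- The negated inner product turns the Fourier integral into `𝓕⁻`, which is self-adjoint for the
    -- bilinear pairing.
    have hflip := VectorFourier.integral_fourierIntegral_smul_eq_flip (μ := volume) (ν := volume)
      (L := -innerₗ (RSpace d)) (e := Real.fourierChar) Real.continuous_fourierChar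
      (continuous_innerₗ_uncurried.neg) hFi hθi
    have hfl : (-innerₗ (RSpace d)).flip = -innerₗ (RSpace d) := by
      ext x y
      simp [real_inner_comm]
    rw [hfl] at hflip
    rw [hηc]
    exact hflip.symm
  rw [← e1, e2]
  have e3 := Measure.integral_comp_smul volume
    (fun u : RSpace d => 𝓕⁻ F ((2 * Real.pi)⁻¹ • u) * (g u : ℂ)) (2 * Real.pi)
  simp only [smul_smul, inv_mul_cancel₀ hpi.ne', one_smul] at e3
  rw [e3, finrank_euclideanSpace_fin, abs_of_nonneg (by positivity), ← integral_smul]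
  refine integral_congr_ae (Eventually.of_forall fun u => ?_)
  simp only [Complex.real_smul]
  ring

/-- A finite measure `k dS + b δ₀` whose Fourier transform `F` is compactly supported has an
entire density; if `k` is square integrable with respect to `S`, whose density is determining, this
forces `F = 0`. -/
theorem eq_zero_of_hasCompactSupport_fourier (hd : 0 < d) {S σ : Measure (RSpace d)}
    [IsLocallyFiniteMeasure S] {s : RSpace d → ℝ≥0∞} (hs : Measurable s)
    (hσ : σ ⟂ₘ (volume : Measure (RSpace d))) (hS : S = σ + volume.withDensity s)
    (hdet : IsDetermining s) {k : RSpace d → ℂ} (hk : Integrable k S)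
    (hk2 : ∫⁻ u, ‖k u‖ₑ ^ 2 ∂S < ⊤) {b : ℂ} {F : RSpace d → ℂ} (hFc : HasCompactSupport F)
    (hF : ∀ x, F x = VectorFourier.fourierIntegral Real.probChar S (innerₗ (RSpace d)) k x + b) :
    F = 0 := by
  have hFcont : Continuous F := by
    have h := (VectorFourier.fourierIntegral_continuous Real.continuous_probChar
      continuous_innerₗ_uncurried hk).add (continuous_const (y := b))
    exact (funext hF : F = _) ▸ h
  have hFi : Integrable F := hFcont.integrable_of_hasCompactSupport hFc
  set G : RSpace d → ℂ := fun u => ((2 * Real.pi) ^ d)⁻¹ • 𝓕⁻ F ((2 * Real.pi)⁻¹ • u) with hG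
  have hGc : Continuous G := by
    have h : Continuous (𝓕⁻ F) := VectorFourier.fourierIntegral_continuous
      Real.continuous_fourierChar (L := -innerₗ (RSpace d)) continuous_innerₗ_uncurried.neg hFi
    exact (h.comp (continuous_const_smul ((2 * Real.pi)⁻¹))).const_smul (((2 * Real.pi) ^ d)⁻¹)
  have hle1 : σ ≤ S := hS ▸ Measure.le_add_right le_rfl
  have hle2 : (volume : Measure (RSpace d)).withDensity s ≤ S := hS ▸ Measure.le_add_left le_rfl
  have hlf2 : IsLocallyFiniteMeasure ((volume : Measure (RSpace d)).withDensity s) :=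
    Measure.isLocallyFiniteMeasure_of_le hle2
  have hsfin := ae_lt_top_of_isLocallyFiniteMeasure_withDensity hs
  have hkσ : Integrable k σ := hk.mono_measure hle1
  have hkw : Integrable k ((volume : Measure (RSpace d)).withDensity s) := hk.mono_measure hle2
  have hkv : Integrable (fun u => (s u).toReal • k u) (volume : Measure (RSpace d)) :=
    (integrable_withDensity_iff_integrable_smul' hs hsfin).1 hkw
  obtain ⟨N, hNm, hσN, hvN⟩ := hσ
  classical
  -- N is σ-null and its complement Lebesgue-null, so H is the density of k dS - G du with respect
  -- to σ + volume. Testing away from the origin shows that H vanishes there.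
  set H : RSpace d → ℂ := fun u => if u ∈ N then (s u).toReal • k u - G u else k u with hH
  have hHσ : H =ᵐ[σ] k := by
    filter_upwards [measure_eq_zero_iff_ae_notMem.1 hσN] with u hu
    simp [hH, hu]
  have hHv : H =ᵐ[volume] fun u => (s u).toReal • k u - G u := by
    filter_upwards [measure_eq_zero_iff_ae_notMem.1 hvN] with u hu
    have : u ∈ N := by simpa using hu
    simp [hH, this]
  have hHσi : LocallyIntegrable H σ := (hkσ.congr hHσ.symm).locallyIntegrable
  have hHvi : LocallyIntegrable H volume :=
    (locallyIntegrable_congr hHv).2 (hkv.locallyIntegrable.sub hGc.locallyIntegrable)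
  have hHi : LocallyIntegrable H (σ + volume) := by
    rw [locallyIntegrable_iff] at hHσi hHvi ⊢
    exact fun K hK => integrableOn_add_measure.2 ⟨hHσi K hK, hHvi K hK⟩
  have hzero : ∀ᵐ u ∂(σ + volume), u ∈ ({0}ᶜ : Set (RSpace d)) → H u = 0 := by
    refine isOpen_compl_singleton.ae_eq_zero_of_integral_contDiff_smul_eq_zero
      (hHi.locallyIntegrableOn _) fun g hg hgc hgs => ?_
    have hg0 : g 0 = 0 := image_eq_zero_of_notMem_tsupport fun h => hgs h rfl
    have h1 := integral_smul_eq_of_fourier hk hFi hF hg hgc hg0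
    have hgk : ∀ {μ : Measure (RSpace d)} {q : RSpace d → ℂ}, LocallyIntegrable q μ →
        Integrable (fun u => g u • q u) μ := fun hq =>
      hq.integrable_smul_left_of_hasCompactSupport hg.continuous hgc
    rw [integral_add_measure (hgk hHσi) (hgk hHvi)]
    have h2 : ∫ u, g u • H u ∂σ = ∫ u, g u • k u ∂σ :=
      integral_congr_ae (hHσ.mono fun u hu => by simp only [hu])
    have h3 : ∫ u, g u • H u = (∫ u, (s u).toReal • (g u • k u)) - ∫ u, g u • G u := by
      have hi : Integrable (fun u => (s u).toReal • (g u • k u))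
          (volume : Measure (RSpace d)) :=
        (hgk hkv.locallyIntegrable).congr (Eventually.of_forall fun u => smul_comm _ _ _)
      refine Eq.trans ?_ (integral_sub hi (hgk hGc.locallyIntegrable))
      refine integral_congr_ae (hHv.mono fun u hu => ?_)
      simp only [hu, smul_sub, smul_comm (g u) (s u).toReal]
    have h4 : ∫ u, g u • k u ∂S = ∫ u, g u • k u ∂σ + ∫ u, (s u).toReal • (g u • k u) := by
      rw [← integral_withDensity_eq_integral_toReal_smul hs hsfin]
      conv_lhs => rw [hS]
      exact integral_add_measure (hgk hkσ.locallyIntegrable) (hgk hkw.locallyIntegrable)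
    rw [h1] at h4
    rw [h2, h3, h4]
    ring
  have hGk : ∀ᵐ u ∂(volume : Measure (RSpace d)), G u = (s u).toReal • k u := by
    have : Nonempty (Fin d) := ⟨⟨0, hd⟩⟩
    have hz : ∀ᵐ u ∂(volume : Measure (RSpace d)), u ≠ 0 :=
      measure_eq_zero_iff_ae_notMem.1 (measure_singleton (0 : RSpace d))
    filter_upwards [(ae_add_measure_iff.1 hzero).2, hHv, hz] with u h1 h2 h3
    rw [h1 h3] at h2
    exact (sub_eq_zero.1 h2.symm).symm
  -- Since G = s k almost everywhere, |G|²/s ≤ s |k|², also where s = 0.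
  have hint : ∫⁻ u, ‖G u‖ₑ ^ 2 / s u < ⊤ := by
    refine lt_of_le_of_lt ?_ ((lintegral_mono' hle2 le_rfl).trans_lt hk2)
    rw [lintegral_withDensity_eq_lintegral_mul_non_measurable _ hs hsfin]
    refine lintegral_mono_ae ?_
    filter_upwards [hGk, hsfin] with u hu hsu
    rw [hu, enorm_smul, mul_pow, Pi.mul_apply]
    have : ‖(s u).toReal‖ₑ = s u := by
      rw [← ofReal_norm, Real.norm_of_nonneg ENNReal.toReal_nonneg, ENNReal.ofReal_toReal hsu.ne]
    rw [this]
    exact ENNReal.div_le_of_le_mul (le_of_eq (by ring))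
  set ψ : (Fin d → ℂ) → ℂ := fun z => ((((2 * Real.pi) ^ d)⁻¹ : ℝ) : ℂ) *
      ∫ x : RSpace d, Complex.exp (Complex.I * ∑ j, z j * (x j : ℂ)) * F x with hψ
  have hψG : ∀ u : RSpace d, ψ (complexify u) = G u := by
    intro u
    simp only [hψ, hG, Complex.real_smul]
    congr 1
    rw [Real.fourierInv_eq']
    refine integral_congr_ae (Eventually.of_forall fun x => ?_)
    simp only [smul_eq_mul]
    congr 2
    have hpi : (2 : ℂ) * Real.pi ≠ 0 := by simp [Real.pi_ne_zero]
    rw [inner_smul_right, PiLp.inner_apply]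
    simp only [complexify, RCLike.inner_apply, conj_trivial]
    push_cast
    rw [mul_inv_cancel_left₀ hpi, mul_comm]
  have hψ0 : ψ = 0 := hdet ψ ((differentiable_fourierLaplace hFcont hFc).const_mul _) (by
    change ∫⁻ u : RSpace d, ‖ψ (complexify u)‖ₑ ^ 2 / s u < ⊤
    simpa only [hψG] using hint)
  have hinv : 𝓕⁻ F = 0 := by
    ext w
    have h := hψG ((2 * Real.pi) • w)
    rw [hψ0, hG] at h
    simp only [smul_smul, inv_mul_cancel₀ (by positivity : (2 * Real.pi) ≠ 0), one_smul] at h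
    have hne : (((2 * Real.pi) ^ d)⁻¹ : ℝ) ≠ 0 := by positivity
    exact (smul_eq_zero.1 h.symm).resolve_left hne
  have hfin : Integrable (𝓕 F) := by
    have h : 𝓕 F = 0 := by
      ext w
      have := congrFun hinv (-w)
      rwa [Real.fourierInv_eq_fourier_neg, neg_neg] at this
    rw [h]
    exact integrable_zero _ _ _
  rw [← hFcont.fourier_fourierInv_eq hFi hfin, hinv]
  ext w
  simp [Real.fourier_eq]

end PaleyWiener

/-! ### Approximation by test functions living off A -/

section Approximation

variable {d : ℕ}

lemma memLp_fourierHat {S : Measure (RSpace d)}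
    (hfin : ∀ f, IsTestFn f → ∫⁻ u, ‖fourierHat f u‖ₑ ^ 2 ∂S < ∞)
    {f : RSpace d → ℂ} (hf : IsTestFn f) : MemLp (fourierHat f) 2 S := by
  refine ⟨(continuous_fourierHat hf).aestronglyMeasurable, ?_⟩
  have h := hfin f hf
  rw [lintegral_enorm_sq_eq_eLpNorm_sq] at h
  by_contra h'
  rw [not_lt, top_le_iff] at h'
  simp [h'] at h

/-- A linear functional on test functions which is invariant under translations. -/
structure IsInvariantFunctional (L : (RSpace d → ℂ) → ℂ) : Prop where
  add : ∀ f g, IsTestFn f → IsTestFn g → L (f + g) = L f + L g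
  smul : ∀ (c : ℂ) f, IsTestFn f → L (c • f) = c * L f
  translate : ∀ x f, IsTestFn f → L (translateFn x f) = L f

/-- The map `f ↦ (f̂, L f)` from test functions living on `B` to `L²(S) × ℂ`. -/
noncomputable def spectralEmbedding {S : Measure (RSpace d)}
    (hfin : ∀ f, IsTestFn f → ∫⁻ u, ‖fourierHat f u‖ₑ ^ 2 ∂S < ∞)
    {L : (RSpace d → ℂ) → ℂ} (hL : IsInvariantFunctional L) (B : Set (RSpace d)) :
    testFnOn B →ₗ[ℂ] WithLp 2 (Lp ℂ 2 S × ℂ) where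
  toFun f := WithLp.toLp 2 ((memLp_fourierHat hfin f.2.toIsTestFn).toLp, L f)
  map_add' f g := by
    rw [← WithLp.toLp_add, Prod.mk_add_mk, ← MemLp.toLp_add]
    congr 2
    · exact MemLp.toLp_congr _ _
        (by rw [← fourierHat_add f.2.toIsTestFn g.2.toIsTestFn]; rfl)
    · exact hL.add _ _ f.2.toIsTestFn g.2.toIsTestFn
  map_smul' c f := by
    rw [← WithLp.toLp_smul, Prod.smul_mk, RingHom.id_apply, ← MemLp.toLp_const_smul]
    congr 2
    · exact MemLp.toLp_congr _ _ (by rw [← fourierHat_smul]; rfl)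
    · exact hL.smul c _ f.2.toIsTestFn

lemma IsTestFnOn.translate_compl {A : Set (RSpace d)} {R : ℝ} (hR : ∀ y ∈ A, ‖y‖ ≤ R)
    {f : RSpace d → ℂ} (hf : IsTestFnOn A f) {x : RSpace d} (hx : 2 * R < ‖x‖) :
    IsTestFnOn Aᶜ (translateFn x f) := by
  refine ⟨hf.toIsTestFn.translate x, fun y hy => hf.zero_off _ fun hyx => ?_⟩
  have h1 := hR y (not_not.1 hy)
  have h2 := hR _ hyx
  have h3 : ‖x‖ ≤ ‖y‖ + ‖y - x‖ := by
    simpa using norm_sub_le y (y - x)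
  linarith

/-- Membership in the closure is shown through the double orthogonal complement in L²(S) × ℂ. The
coordinate L lets the same sequence approximate `f̂` and L f together. -/
theorem exists_testFn_approx (hd : 0 < d) {S σ : Measure (RSpace d)} {s : RSpace d → ℝ≥0∞}
    (hs : Measurable s) (hσ : σ ⟂ₘ (volume : Measure (RSpace d)))
    (hS : S = σ + volume.withDensity s) (hdet : IsDetermining s)
    (hfin : ∀ f, IsTestFn f → ∫⁻ u, ‖fourierHat f u‖ₑ ^ 2 ∂S < ∞)
    {L : (RSpace d → ℂ) → ℂ} (hL : IsInvariantFunctional L) {A : Set (RSpace d)}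
    (hA : Bornology.IsBounded A) {f : RSpace d → ℂ} (hf : IsTestFnOn A f) :
    ∃ h : ℕ → RSpace d → ℂ, (∀ n, IsTestFnOn Aᶜ (h n)) ∧
      Tendsto (fun n => ∫⁻ u, ‖fourierHat (h n - f) u‖ₑ ^ 2 ∂S) atTop (𝓝 0) ∧
      Tendsto (fun n => L (h n)) atTop (𝓝 (L f)) := by
  have hloc := isLocallyFiniteMeasure_of_lintegral_fourierHat_lt_top hfin
  set Φ := spectralEmbedding hfin hL with hΦ
  have hfu : ∀ {q : RSpace d → ℂ}, IsTestFn q → q ∈ testFnOn (Set.univ : Set (RSpace d)) :=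
    fun hq => ⟨hq, fun x hx => absurd (Set.mem_univ x) hx⟩
  have hmem : Φ Set.univ ⟨f, hfu hf.toIsTestFn⟩ ∈ (LinearMap.range (Φ Aᶜ)).topologicalClosure := by
    rw [← Submodule.orthogonal_orthogonal_eq_closure, Submodule.mem_orthogonal]
    intro y hy
    rw [Submodule.mem_orthogonal'] at hy
    obtain ⟨R, hR⟩ := hA.exists_norm_le
    -- k is S-integrable as a product of two L² functions, and square integrable because `f̂` is
    -- bounded.
    set k : RSpace d → ℂ := fun u => inner ℂ (y.fst u) (fourierHat f u) with hk
    set F : RSpace d → ℂ := fun x =>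
      inner ℂ y (Φ Set.univ ⟨translateFn x f, hfu (hf.toIsTestFn.translate x)⟩) with hFdef
    have hFc : HasCompactSupport F := by
      refine HasCompactSupport.intro (isCompact_closedBall (0 : RSpace d) (2 * R)) fun x hx => ?_
      rw [mem_closedBall_zero_iff, not_le] at hx
      exact hy _ ⟨⟨translateFn x f, hf.translate_compl hR hx⟩, rfl⟩
    have hF : ∀ x, F x = VectorFourier.fourierIntegral Real.probChar S (innerₗ (RSpace d)) k x
        + inner ℂ y.snd (L f) := by
      intro x
      have h1 : F x = inner ℂ y.fst
          ((memLp_fourierHat hfin (hf.toIsTestFn.translate x)).toLp) +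
          inner ℂ y.snd (L (translateFn x f)) := WithLp.prod_inner_apply _ _
      rw [h1, hL.translate x f hf.toIsTestFn, L2.inner_def]
      congr 1
      refine integral_congr_ae ?_
      filter_upwards [(memLp_fourierHat hfin (hf.toIsTestFn.translate x)).coeFn_toLp] with u hu
      rw [hu, fourierHat_translateFn, exp_neg_I_mul_ofReal, Circle.smul_def, innerₗ_apply_apply,
        smul_eq_mul, ← smul_eq_mul, inner_smul_right]
    have hki : Integrable k S := by
      refine (L2.integrable_inner (𝕜 := ℂ) y.fst
        ((memLp_fourierHat hfin hf.toIsTestFn).toLp)).congr ?_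
      filter_upwards [(memLp_fourierHat hfin hf.toIsTestFn).coeFn_toLp] with u hu
      rw [hu]
    have hk2 : ∫⁻ u, ‖k u‖ₑ ^ 2 ∂S < ∞ := by
      have hy2 : ∫⁻ u, ‖y.fst u‖ₑ ^ 2 ∂S < ∞ := by
        rw [lintegral_enorm_sq_eq_eLpNorm_sq]
        exact ENNReal.pow_lt_top (Lp.memLp y.fst).2
      set C : ℝ≥0∞ := ENNReal.ofReal (∫ x, ‖f x‖) with hC
      calc ∫⁻ u, ‖k u‖ₑ ^ 2 ∂S ≤ ∫⁻ u, C ^ 2 * ‖y.fst u‖ₑ ^ 2 ∂S := by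
            refine lintegral_mono fun u => ?_
            rw [← mul_pow]
            gcongr
            rw [← ofReal_norm, ← ofReal_norm, hC, ← ENNReal.ofReal_mul (by positivity)]
            refine ENNReal.ofReal_le_ofReal ((norm_inner_le_norm _ _).trans ?_)
            rw [mul_comm]
            exact mul_le_mul_of_nonneg_right (norm_fourierHat_le f u) (norm_nonneg _)
        _ = C ^ 2 * ∫⁻ u, ‖y.fst u‖ₑ ^ 2 ∂S :=
            lintegral_const_mul' _ _ (ENNReal.pow_ne_top ENNReal.ofReal_ne_top)
        _ < ∞ := ENNReal.mul_lt_top (ENNReal.pow_lt_top ENNReal.ofReal_lt_top) hy2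
    have h0 := congrFun
      (eq_zero_of_hasCompactSupport_fourier hd hs hσ hS hdet hki hk2 hFc hF) 0
    have htr : translateFn 0 f = f := by
      ext x
      simp [translateFn]
    simpa only [hFdef, htr, Pi.zero_apply] using h0
  obtain ⟨v, hv, hlim⟩ := mem_closure_iff_seq_limit.1 hmem
  choose h hh using hv
  refine ⟨fun n => (h n : RSpace d → ℂ), fun n => (h n).2, ?_, ?_⟩
  · have h1 := ((WithLp.prod_continuous_ofLp 2 (Lp ℂ 2 S) ℂ).fst.tendsto _).comp hlim
    have h2 : Tendsto (fun n => (memLp_fourierHat hfin (h n).2.toIsTestFn).toLp) atTop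
        (𝓝 ((memLp_fourierHat hfin hf.toIsTestFn).toLp)) := by
      refine h1.congr fun n => ?_
      simp only [Function.comp_apply, ← hh n]
      rfl
    have h3 := (Lp.tendsto_Lp_iff_tendsto_eLpNorm'' _ _ _ _).1 h2
    have h4 := ((ENNReal.continuous_pow 2).tendsto 0).comp h3
    rw [zero_pow two_ne_zero] at h4
    refine h4.congr fun n => ?_
    rw [lintegral_enorm_sq_eq_eLpNorm_sq, fourierHat_sub (h n).2.toIsTestFn hf.toIsTestFn]
    rfl
  · have h1 := ((WithLp.prod_continuous_ofLp 2 (Lp ℂ 2 S) ℂ).snd.tendsto _).comp hlim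
    refine h1.congr fun n => ?_
    simp only [Function.comp_apply, ← hh n]
    rfl

end Approximation

/-! ### From linear approximation to rigidity -/

lemma measurable_limUnder {Ω : Type*} {mΩ : MeasurableSpace Ω} {Y : ℕ → Ω → ℂ}
    (hY : ∀ n, Measurable (Y n)) : Measurable fun ω => limUnder atTop fun n => Y n ω :=
  (StronglyMeasurable.limUnder fun n => (hY n).stronglyMeasurable).measurable

lemma measurable_sigmaOn {d : ℕ} {Ω : Type*} {M : (RSpace d → ℂ) → Ω → ℂ}
    {B : Set (RSpace d)} {f : RSpace d → ℂ} (hf : IsTestFnOn B f) :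
    Measurable[sigmaOn M B] (M f) := by
  rw [measurable_iff_comap_le, BorelSpace.measurable_eq (α := ℂ)]
  exact le_iSup (fun f : {f : RSpace d → ℂ // IsTestFnOn B f} =>
    MeasurableSpace.comap (M f.1) (borel ℂ)) ⟨f, hf⟩

section Rigidity

variable {d : ℕ} {Ω : Type*} [MeasurableSpace Ω] {P : Measure Ω} [IsProbabilityMeasure P]
  {M : (RSpace d → ℂ) → Ω → ℂ}

lemma HasStationaryMean.isInvariantFunctional (hM : IsWeaklyStationaryRandomMeasure P M)
    (hmean : HasStationaryMean P M) : IsInvariantFunctional fun f => ∫ ω, M f ω ∂P :=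
  ⟨fun _ _ hf hg => hM.mean_add hf hg, fun c _ hf => hM.mean_smul c hf, fun x f hf => hmean x f hf⟩

lemma tendsto_eLpNorm_centred (hM : IsWeaklyStationaryRandomMeasure P M)
    {S : Measure (RSpace d)} (hS : IsSpectralMeasure P M S) {f : RSpace d → ℂ} (hf : IsTestFn f)
    {h : ℕ → RSpace d → ℂ} (hh : ∀ n, IsTestFn (h n))
    (hlim : Tendsto (fun n => ∫⁻ u, ‖fourierHat (h n - f) u‖ₑ ^ 2 ∂S) atTop (𝓝 0)) :
    Tendsto (fun n => eLpNorm (centred P M (h n) - centred P M f) 2 P) atTop (𝓝 0) := by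
  have h1 : Tendsto (fun n => complexVar P (M (h n - f))) atTop (𝓝 0) := by
    have := ENNReal.Tendsto.const_mul (a := ENNReal.ofReal (((2 * Real.pi) ^ d)⁻¹)) hlim
      (Or.inr ENNReal.ofReal_ne_top)
    rw [mul_zero] at this
    exact this.congr fun n => (hS _ ((hh n).sub hf)).symm
  have h2 := (ENNReal.continuous_rpow_const (y := (2 : ℝ)⁻¹)).tendsto 0 |>.comp h1
  rw [ENNReal.zero_rpow_of_pos (by norm_num)] at h2
  refine h2.congr fun n => ?_
  rw [Function.comp_apply, IsWeaklyStationaryRandomMeasure.complexVar_eq_eLpNorm_centred_sq,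
    ← ENNReal.rpow_natCast, ← ENNReal.rpow_mul]
  simp only [Nat.cast_ofNat, mul_inv_cancel₀ (two_ne_zero' ℝ), ENNReal.rpow_one]
  exact eLpNorm_congr_ae (hM.centred_sub_ae_eq (hh n) hf)

lemma tendsto_eLpNorm_of_centred (hM : IsWeaklyStationaryRandomMeasure P M)
    {f : RSpace d → ℂ} (hf : IsTestFn f) {h : ℕ → RSpace d → ℂ} (hh : ∀ n, IsTestFn (h n))
    (hlim : Tendsto (fun n => eLpNorm (centred P M (h n) - centred P M f) 2 P) atTop (𝓝 0))
    (hmean : Tendsto (fun n => ∫ ω, M (h n) ω ∂P) atTop (𝓝 (∫ ω, M f ω ∂P))) :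
    Tendsto (fun n => eLpNorm (M (h n) - M f) 2 P) atTop (𝓝 0) := by
  have h1 : Tendsto (fun n => ‖∫ ω, M (h n) ω ∂P - ∫ ω, M f ω ∂P‖ₑ) atTop (𝓝 0) := by
    have := (continuous_enorm.tendsto _).comp (hmean.sub_const (∫ ω, M f ω ∂P))
    simpa [Function.comp_def] using this
  have h2 := hlim.add h1
  rw [add_zero] at h2
  refine tendsto_of_tendsto_of_tendsto_of_le_of_le tendsto_const_nhds h2
    (fun n => zero_le) fun n => ?_
  have heq : M (h n) - M f = (centred P M (h n) - centred P M f) +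
      fun _ => (∫ ω, M (h n) ω ∂P - ∫ ω, M f ω ∂P) := by
    ext ω
    simp only [centred, Pi.add_apply, Pi.sub_apply]
    ring
  rw [heq]
  refine (eLpNorm_add_le ((hM.memLp_centred (hh n)).sub (hM.memLp_centred hf)).1
    aestronglyMeasurable_const one_le_two).trans (le_of_eq ?_)
  rw [eLpNorm_const _ two_ne_zero (IsProbabilityMeasure.ne_zero P), measure_univ,
    ENNReal.one_rpow, mul_one]

/-- L² convergence gives an almost surely convergent subsequence. Its pointwise limit, with a junk
value where there is none, is measurable for the σ-algebra of M off A, without completion. -/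
lemma IsLinearlyMaximallyRigidOn.isMaximallyRigidOn (hM : IsWeaklyStationaryRandomMeasure P M)
    {A : Set (RSpace d)} (hlin : IsLinearlyMaximallyRigidOn P (centred P M) A) :
    IsMaximallyRigidOn P M A := by
  have key : ∀ f, IsTestFnOn A f → ∃ X : Ω → ℂ, Measurable[sigmaOn M Aᶜ] X ∧ M f =ᵐ[P] X := by
    intro f hf
    obtain ⟨h, hh, hlim⟩ := hlin f hf
    obtain ⟨ns, -, hns⟩ := (tendstoInMeasure_of_tendsto_eLpNorm two_ne_zero
      (fun n => (hM.memLp_centred (hh n).toIsTestFn).1) (hM.memLp_centred hf.toIsTestFn).1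
      hlim).exists_seq_tendsto_ae
    set Y : ℕ → Ω → ℂ := fun n ω => centred P M (h (ns n)) ω + ∫ ω', M f ω' ∂P with hY
    have hmeas : ∀ n, Measurable[sigmaOn M Aᶜ] (Y n) := fun n =>
      ((measurable_sigmaOn (hh (ns n))).sub_const _).add_const _
    refine ⟨fun ω => limUnder atTop fun n => Y n ω,
      measurable_limUnder (mΩ := sigmaOn M Aᶜ) hmeas, ?_⟩
    filter_upwards [hns] with ω hω
    rw [(hω.add_const (∫ ω', M f ω' ∂P)).limUnder_eq]
    simp [centred]
  -- The events almost surely equal to one determined by M off A form a σ-algebra, so only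
  -- generators need checking.
  have hle : sigmaOn M A ≤ eventuallyMeasurableSpace (sigmaOn M Aᶜ) (ae P) := by
    refine iSup_le fun f => ?_
    rintro _ ⟨B, hB, rfl⟩
    obtain ⟨X, hX, hXeq⟩ := key f.1 f.2
    rw [← BorelSpace.measurable_eq (α := ℂ)] at hB
    exact ⟨X ⁻¹' B, hX hB, hXeq.preimage B⟩
  exact fun E hE => hle E hE

end Rigidity

theorem mainTheorem12 {d : ℕ} (hd : 0 < d) {Ω : Type*} [MeasurableSpace Ω]
    (P : Measure Ω) [IsProbabilityMeasure P]
    (M : (RSpace d → ℂ) → Ω → ℂ) (hM : IsWeaklyStationaryRandomMeasure P M)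
    (s : RSpace d → ℝ≥0∞) (hs : HasSpectralDensity P M s) :
    (IsDetermining s → ∀ A : Set (RSpace d), Bornology.IsBounded A →
      IsMaximallyRigidOn P M A ∧
      IsLinearlyMaximallyRigidOn P (centred P M) A ∧
      (HasStationaryMean P M → IsLinearlyMaximallyRigidOn P M A)) ∧
    (HasDeepZero s → IsDetermining s) ∧
    (d = 1 → HasIntegralDeepZero s → IsDetermining s) := by
  obtain ⟨S, σ, hspec, hsm, hσ, hS⟩ := hs
  have hfin : ∀ f, IsTestFn f → ∫⁻ u, ‖fourierHat f u‖ₑ ^ 2 ∂S < ∞ := fun f hf =>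
    hspec.lintegral_lt_top hM hf
  refine ⟨fun hdet A hA => ?_, isDetermining_of_hasDeepZero hsm, ?_⟩
  · have hlin : IsLinearlyMaximallyRigidOn P (centred P M) A := by
      intro f hf
      -- For the centred measure the means play no role, so L = 0 suffices.
      have h0 : IsInvariantFunctional (d := d) fun _ => 0 :=
        ⟨fun _ _ _ _ => (add_zero 0).symm, fun c _ _ => (mul_zero c).symm, fun _ _ _ => rfl⟩
      obtain ⟨h, hh, hlim, -⟩ := exists_testFn_approx hd hsm hσ hS hdet hfin h0 hA hf
      exact ⟨h, hh, tendsto_eLpNorm_centred hM hspec hf.toIsTestFn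
        (fun n => (hh n).toIsTestFn) hlim⟩
    refine ⟨hlin.isMaximallyRigidOn hM, hlin, fun hmean f hf => ?_⟩
    obtain ⟨h, hh, hlim, hL⟩ := exists_testFn_approx hd hsm hσ hS hdet hfin
      (hmean.isInvariantFunctional hM) hA hf
    exact ⟨h, hh, tendsto_eLpNorm_of_centred hM hf.toIsTestFn (fun n => (hh n).toIsTestFn)
      (tendsto_eLpNorm_centred hM hspec hf.toIsTestFn (fun n => (hh n).toIsTestFn) hlim) hL⟩
  · rintro rfl
    exact isDetermining_of_hasIntegralDeepZero
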